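/- **Setting.** For $X\subset\mathbb R^d$ and $\varepsilon\in\mathbb R$ let $\check C(X,\varepsilon)$ be the simplicial complex of all nonempty finite $\sigma\subseteq X$ such that the closed balls of radius $\varepsilon/2$ in $\mathbb R^d$ around the points of $\sigma$ have a common point (it is empty for $\varepsilon<0$). For $s\le t$ let $M^{s,t}:H_0(\check C(X,s);\mathbb Z_2)\to H_0(\check C(X,t);\mathbb Z_2)$ be induced by inclusion, where, by convention, the maximal death time is $\operatorname{diam}X$: for bounded $X$ the module is replaced by $0$ at all times $t\ge\operatorname{diam}X$, so that the class that never dies gets death time $\operatorname{diam} X$. The $H_0$ Čech persistence landscape of $X$ is $\mathbf f=\{f^{(n)}\}_{n\ge1}$, $f^{(n)}(t)=\sup\{m\ge0 : \operatorname{rank}M^{t-m,t+m}\ge n\}$, with $\sup\emptyset=0$. Let $L^\infty(\mathbb N\times\mathbb R)$ be the space of sequences $\mathbf g=\{g^{(n)}\}_{n\ge 1}$ in $L^\infty(\mathbb R)$ with norm $\sup_n\|g^{(n)}\|_{L^\infty(\mathbb R)}<\infty$, and let $\tau_{(0,b)}(t)=\max(0,\min(t,b-t))$. Let $c\in(0,1)$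 and let $\Psi=\{\psi_1,\dots,\psi_N\}$ be maps $\mathbb R^d\to\mathbb R^d$ with $|\psi_j(x)-\psi_j(y)|=c|x-y|$ for all $x,y$. Let $A$ be the invariant set of $\Psi$, i.e. the nonempty closed bounded set with $A=\bigcup_j\psi_j(A)$, and assume that $\Psi$ has well-separated images: $$d(\psi_j(A),\psi_k(A))\ \ge\ \operatorname{diam}\psi_i(A)\qquad\text{for all } j\ne k\text{ and all } i,$$ where $d(Y,Z)=\inf\{|y-z| : y\in Y,z\in Z\}$ (and $d(Y,\emptyset)=\infty$). A set is *$\varepsilon$-connected* if it is not the union of two nonempty sets $Y,Z$ with $d(Y,Z)>\varepsilon$; an *$\varepsilon$-component* of $A$ is a nonempty $\varepsilon$-connected $Y\subseteq A$ with $d(Y,A\setminus Y)>\varepsilon$; $C(A,\varepsilon)$ is the number of $\varepsilon$-components of $A$. Put $\delta_1=\operatorname{diam}A$ and $\delta_k=\inf\{\varepsilon>0 : C(A,\varepsilon)\le k-1\}$ for $2\le k\le N$. Define $\mathcal L:L^\infty(\mathbb N\times\mathbb R)\to L^\infty(\mathbb N\times\mathbb R)$ by $\mathcal L\mathbf g=\mathbf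 h$, where $$h^{(j)}=\tau_{(0,\delta_j)}\ \ (1\le j\le N),\qquad h^{(kN+i)}(x)=c\,g^{(k+1)}(c^{-1}x)\ \ (k\ge1,\ 1\le i\le N).$$ **Theorem.** The operator $\mathcal L$ is affine (a constant plus a bounded linear operator) and is a contraction with constant $c$. The $H_0$ Čech persistence landscape $\mathbf f$ of $A$ takes finite values, belongs to $L^\infty(\mathbb N\times\mathbb R)$ and satisfies $\mathcal L\mathbf f=\mathbf f$; it is the only fixed point of $\mathcal L$, and $\mathcal L^n\mathbf g\to\mathbf f$ as $n\to\infty$ for every $\mathbf g\in L^\infty(\mathbb N\times\mathbb R)$. Moreover, for every $t\in\mathbb R$, $$f^{(j)}(t)=\begin{cases}\tau_{(0,\delta_j)}(t), & 1\le j\le N,\\ \tau_{(0,c^k\delta_l)}(t), & (l-1)N^k<j\le lN^k\ \text{ with } k\ge1,\ 2\le l\le N.\end{cases}$$ -/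

import Mathlib

open MeasureTheory
open scoped ENNReal NNReal

/-! ### Simplicial homology with coefficients in `ZMod 2` -/

namespace SimplicialHomology

variable {V : Type*}

/-- Finite formal `ZMod 2`-linear combinations of finite subsets of `V`. -/
abbrev FormalChains (V : Type*) : Type _ := Finset V →₀ ZMod 2

noncomputable instance : AddCommGroup (FormalChains V) := Finsupp.instAddCommGroup

/-- The `p`-chains of `K`: finite formal `ZMod 2`-linear combinations of the `p`-simplices of `K`,
i.e. of the faces of `K` with `p + 1` vertices. -/
def chains (K : PreAbstractSimplicialComplex V) (p : ℕ) : Submodule (ZMod 2) (FormalChains V) :=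
  Finsupp.supported (ZMod 2) (ZMod 2) {σ | σ ∈ K ∧ σ.card = p + 1}

open Classical in
/-- The boundary operator: a simplex is sent to the sum of its facets. -/
noncomputable def boundary : (FormalChains V) →ₗ[ZMod 2] (FormalChains V) :=
  Finsupp.linearCombination (ZMod 2)
    (fun σ : Finset V => ∑ x ∈ σ, Finsupp.single (σ.erase x) (1 : ZMod 2))

/-- The `p`-cycles of `K`. The differential on `0`-chains is zero, so every `0`-chain is a
cycle. -/
noncomputable def cycles (K : PreAbstractSimplicialComplex V) :
    ℕ → Submodule (ZMod 2) (FormalChains V)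
  | 0 => chains K 0
  | p + 1 => chains K (p + 1) ⊓ LinearMap.ker boundary

/-- The `p`-boundaries of `K`. -/
noncomputable def boundaries (K : PreAbstractSimplicialComplex V) (p : ℕ) :
    Submodule (ZMod 2) (FormalChains V) :=
  (chains K (p + 1)).map boundary

/-- The `p`-th simplicial homology of `K` with coefficients in `ZMod 2`: cycles modulo
boundaries. -/
abbrev Homology (K : PreAbstractSimplicialComplex V) (p : ℕ) : Type _ :=
  (cycles K p) ⧸ ((boundaries K p).submoduleOf (cycles K p))

theorem chains_mono {K L : PreAbstractSimplicialComplex V} (h : K ≤ L) (p : ℕ) :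
    chains K p ≤ chains L p :=
  Finsupp.supported_mono fun _ hσ => ⟨h hσ.1, hσ.2⟩

theorem cycles_mono {K L : PreAbstractSimplicialComplex V} (h : K ≤ L) :
    ∀ p : ℕ, cycles K p ≤ cycles L p
  | 0 => chains_mono h 0
  | p + 1 => inf_le_inf_right _ (chains_mono h (p + 1))

theorem boundaries_mono {K L : PreAbstractSimplicialComplex V} (h : K ≤ L) (p : ℕ) :
    boundaries K p ≤ boundaries L p :=
  Submodule.map_mono (chains_mono h (p + 1))

/-- The homomorphism `H_p(K) → H_p(L)` induced by the inclusion of a subcomplex `K ≤ L`. -/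
noncomputable def homologyMap {K L : PreAbstractSimplicialComplex V} (h : K ≤ L) (p : ℕ) :
    Homology K p →ₗ[ZMod 2] Homology L p :=
  Submodule.mapQ _ _ (Submodule.inclusion (cycles_mono h p))
    (fun _ hx => boundaries_mono h p hx)

theorem homologyMap_refl (K : PreAbstractSimplicialComplex V) (p : ℕ) :
    homologyMap (le_refl K) p = LinearMap.id := by
  apply Submodule.linearMap_qext
  ext x : 1
  rfl

theorem homologyMap_comp {K L M : PreAbstractSimplicialComplex V} (h : K ≤ L) (h' : L ≤ M)
    (p : ℕ) : homologyMap h' p ∘ₗ homologyMap h p = homologyMap (h.trans h') p := by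
  apply Submodule.linearMap_qext
  ext x : 1
  rfl

end SimplicialHomology

/-! ### Persistence modules and landscapes -/

/-- A persistence module over `ZMod 2` indexed by `ℝ`. -/
structure PersistenceModule where
  V : ℝ → Type
  [addCommGroup : ∀ t, AddCommGroup (V t)]
  [module : ∀ t, Module (ZMod 2) (V t)]
  map : ∀ {s t : ℝ}, s ≤ t → V s →ₗ[ZMod 2] V t
  map_refl : ∀ t : ℝ, map (le_refl t) = LinearMap.id
  map_comp : ∀ {r s t : ℝ} (hrs : r ≤ s) (hst : s ≤ t), map hst ∘ₗ map hrs = map (hrs.trans hst)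

namespace PersistenceModule

attribute [instance] PersistenceModule.addCommGroup PersistenceModule.module

/-- The submodule of `V t` that is divided out when everything is declared dead at time `T`. -/
noncomputable def cut (M : PersistenceModule) (T t : ℝ) : Submodule (ZMod 2) (M.V t) :=
  open Classical in if t < T then ⊥ else ⊤

theorem cut_le (M : PersistenceModule) (T : ℝ) {s t : ℝ} (h : s ≤ t) :
    M.cut T s ≤ (M.cut T t).comap (M.map h) := by
  unfold cut
  by_cases ht : t < T
  · simp [h.trans_lt ht]
  · simp [ht]

/-- The persistence module that agrees with `M` at times `t < T` and is zero at times `t ≥ T`: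
every class that is still alive at time `T` dies at time `T`. -/
noncomputable def truncate (M : PersistenceModule) (T : ℝ) : PersistenceModule where
  V t := M.V t ⧸ M.cut T t
  map h := Submodule.mapQ _ _ (M.map h) (M.cut_le T h)
  map_refl t := by
    apply Submodule.linearMap_qext
    ext x
    simp [M.map_refl]
  map_comp hrs hst := by
    apply Submodule.linearMap_qext
    ext x
    simp [← M.map_comp hrs hst]

/-- The persistence landscape `f⁽ⁿ⁾(t) = sup {m ≥ 0 | rank M^{t - m, t + m} ≥ n}`, with values in
`[0, ∞]`; the supremum over the empty set is `0`. -/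
noncomputable def landscape (M : PersistenceModule) (n : ℕ) (t : ℝ) : ℝ≥0∞ :=
  ⨆ (m : ℝ≥0) (_ : (n : Cardinal) ≤
    LinearMap.rank (M.map (show t - m ≤ t + m by linarith [m.coe_nonneg]))), (m : ℝ≥0∞)

end PersistenceModule

/-! ### The Čech filtration -/

section Cech

variable {E : Type} [PseudoMetricSpace E]

/-- The Čech complex of `X ⊆ E` at scale `ε`: the nonempty finite `σ ⊆ X` for which the closed
balls of radius `ε / 2` (in `E`) around the points of `σ` have a common point. It is empty for
`ε < 0`, because then the balls are empty. -/
def cechComplex (X : Set E) (ε : ℝ) : PreAbstractSimplicialComplex E where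
  faces := {σ | σ.Nonempty ∧ (σ : Set E) ⊆ X ∧ (⋂ x ∈ σ, Metric.closedBall x (ε / 2)).Nonempty}
  isRelLowerSet_faces := by
    rintro σ ⟨h1, h2, y, hy⟩
    refine ⟨h1, fun τ hτ hne => ⟨hne, fun x hx => h2 (hτ hx), y, ?_⟩⟩
    simp only [Set.mem_iInter] at hy ⊢
    exact fun x hx => hy x (hτ hx)

theorem cechComplex_mono (X : Set E) {s t : ℝ} (h : s ≤ t) : cechComplex X s ≤ cechComplex X t := by
  rintro σ ⟨h1, h2, y, hy⟩
  refine ⟨h1, h2, y, ?_⟩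
  simp only [Set.mem_iInter] at hy ⊢
  exact fun x hx => Metric.closedBall_subset_closedBall (by linarith) (hy x hx)

/-- The persistence module `H_p` of the Čech filtration of `X`. -/
noncomputable def cechModule (X : Set E) (p : ℕ) : PersistenceModule where
  V t := SimplicialHomology.Homology (cechComplex X t) p
  map h := SimplicialHomology.homologyMap (cechComplex_mono X h) p
  map_refl _ := SimplicialHomology.homologyMap_refl _ p
  map_comp _ _ := SimplicialHomology.homologyMap_comp _ _ p

/-- The persistence landscape of the zeroth homology of the Čech filtration of a bounded set `X`,
with the convention that the maximal death time is the diameter of `X`: the class that never dies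
is given the death time `diam X`. -/
noncomputable def cechLandscape (X : Set E) : ℕ → ℝ → ℝ≥0∞ :=
  ((cechModule X 0).truncate (Metric.diam X)).landscape

end Cech

/-! ### Iterated function systems, well-separated images and resolutions -/

section IFS

variable {E : Type} [PseudoMetricSpace E]

/-- `A` is the invariant set of the IFS `ψ`: the nonempty closed bounded set with
`A = ⋃ j, ψ j '' A`. -/
structure IsInvariantSet {N : ℕ} (ψ : Fin N → E → E) (A : Set E) : Prop where
  nonempty : A.Nonempty
  isClosed : IsClosed A
  isBounded : Bornology.IsBounded A
  eq_iUnion_image : A = ⋃ j, ψ j '' A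

/-- The distance `d(Y, Z) = inf {d(y, z) | y ∈ Y, z ∈ Z}` of two sets (`∞` if one of them is
empty). -/
noncomputable def setEDist (Y Z : Set E) : ℝ≥0∞ := ⨅ (y ∈ Y) (z ∈ Z), edist y z

/-- Well-separated images: `min_{j ≠ k} d(ψ_j(A), ψ_k(A)) ≥ max_i diam ψ_i(A)`. -/
def WellSeparatedImages {N : ℕ} (ψ : Fin N → E → E) (A : Set E) : Prop :=
  ∀ j k : Fin N, j ≠ k → ∀ i : Fin N, Metric.ediam (ψ i '' A) ≤ setEDist (ψ j '' A) (ψ k '' A)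

/-- `X` is `ε`-connected: it is not a union of two nonempty sets at distance `> ε`. -/
def EpsConnected (X : Set E) (ε : ℝ) : Prop :=
  ¬ ∃ Y Z : Set E, Y.Nonempty ∧ Z.Nonempty ∧ X = Y ∪ Z ∧ ENNReal.ofReal ε < setEDist Y Z

/-- `Y` is an `ε`-component of `X`. -/
def IsEpsComponent (X : Set E) (ε : ℝ) (Y : Set E) : Prop :=
  Y ⊆ X ∧ Y.Nonempty ∧ EpsConnected Y ε ∧ ENNReal.ofReal ε < setEDist Y (X \ Y)

/-- `C(X, ε)`, the number of `ε`-components of `X`. -/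
noncomputable def epsComponentCount (X : Set E) (ε : ℝ) : ℕ∞ := {Y | IsEpsComponent X ε Y}.encard

/-- The resolutions: `δ_1 = diam A` and `δ_k = inf {ε > 0 | C(A, ε) ≤ k - 1}` for `k ≥ 2`. -/
noncomputable def resolution (A : Set E) (k : ℕ) : ℝ :=
  if k = 1 then Metric.diam A
  else sInf {ε : ℝ | 0 < ε ∧ epsComponentCount A ε ≤ ((k - 1 : ℕ) : ℕ∞)}

end IFS

/-! ### The space `L^∞(ℕ × ℝ)` and the operator -/

/-- The hat function `τ_{(0, b)}`. -/
def hat (b t : ℝ) : ℝ := max 0 (min t (b - t))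

/-- `L^∞(ℕ × ℝ)`, `ℕ = {1, 2, …}`: the bounded sequences in `L^∞(ℝ)` with the supremum norm. -/
abbrev LInf : Type := lp (fun _ : ℕ+ => Lp ℝ ∞ (volume : Measure ℝ)) ∞

theorem continuous_hat (b : ℝ) : Continuous (hat b) := by
  unfold hat
  fun_prop

theorem norm_hat_le (b t : ℝ) : ‖hat b t‖ ≤ |b| := by
  unfold hat
  rw [Real.norm_eq_abs, abs_of_nonneg (le_max_left _ _)]
  refine max_le (abs_nonneg b) ?_
  rcases le_total t 0 with h | h
  · exact (min_le_left _ _).trans (h.trans (abs_nonneg b))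
  · exact (min_le_right _ _).trans (by linarith [le_abs_self b])

theorem memLp_hat (b : ℝ) : MemLp (hat b) ∞ (volume : Measure ℝ) :=
  memLp_top_of_bound (continuous_hat b).aestronglyMeasurable |b|
    (Filter.Eventually.of_forall (norm_hat_le b))

/-- The hat function `τ_{(0, b)}` as an element of `L^∞(ℝ)`. -/
noncomputable def hatLp (b : ℝ) : Lp ℝ ∞ (volume : Measure ℝ) := (memLp_hat b).toLp (hat b)

theorem norm_toLp_top_le {f : ℝ → ℝ} (hf : MemLp f ∞ (volume : Measure ℝ)) {C : ℝ} (hC : 0 ≤ C)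
    (h : ∀ᵐ x, ‖f x‖ ≤ C) : ‖hf.toLp f‖ ≤ C := by
  rw [Lp.norm_toLp, eLpNorm_exponent_top]
  exact ENNReal.toReal_le_of_le_ofReal hC (eLpNormEssSup_le_of_ae_bound h)

theorem norm_hatLp_le (b : ℝ) : ‖hatLp b‖ ≤ |b| :=
  norm_toLp_top_le _ (abs_nonneg b) (Filter.Eventually.of_forall (norm_hat_le b))

theorem quasiMeasurePreserving_inv_mul {c : ℝ} (hc : 0 < c) :
    Measure.QuasiMeasurePreserving (fun x : ℝ => c⁻¹ * x) volume volume :=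
  Measure.quasiMeasurePreserving_smul (μ := (volume : Measure ℝ)) (inv_ne_zero hc.ne')

theorem ae_norm_rescale_le {c : ℝ} (hc : 0 < c) (g : Lp ℝ ∞ (volume : Measure ℝ)) :
    ∀ᵐ x : ℝ, ‖c * g (c⁻¹ * x)‖ ≤ c * ‖g‖ := by
  have h : ∀ᵐ y : ℝ, ‖g y‖ ≤ ‖g‖ := by
    filter_upwards [ae_le_eLpNormEssSup (f := g) (μ := (volume : Measure ℝ))] with y hy
    rw [Lp.norm_def, eLpNorm_exponent_top, ← toReal_enorm]
    refine ENNReal.toReal_mono ?_ hy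
    rw [← eLpNorm_exponent_top]
    exact Lp.eLpNorm_ne_top g
  filter_upwards [(quasiMeasurePreserving_inv_mul hc).ae h] with x hx
  rw [norm_mul, Real.norm_of_nonneg hc.le]
  exact mul_le_mul_of_nonneg_left hx hc.le

theorem memLp_rescale {c : ℝ} (hc : 0 < c) (g : Lp ℝ ∞ (volume : Measure ℝ)) :
    MemLp (fun x : ℝ => c * g (c⁻¹ * x)) ∞ (volume : Measure ℝ) :=
  memLp_top_of_bound
    (((Lp.aestronglyMeasurable g).comp_quasiMeasurePreserving
      (quasiMeasurePreserving_inv_mul hc)).const_mul c) (c * ‖g‖) (ae_norm_rescale_le hc g)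

/-- The function `x ↦ c g(c⁻¹ x)` as an element of `L^∞(ℝ)`. -/
noncomputable def rescale {c : ℝ} (hc : 0 < c) (g : Lp ℝ ∞ (volume : Measure ℝ)) :
    Lp ℝ ∞ (volume : Measure ℝ) :=
  (memLp_rescale hc g).toLp (fun x : ℝ => c * g (c⁻¹ * x))

theorem norm_rescale_le {c : ℝ} (hc : 0 < c) (g : Lp ℝ ∞ (volume : Measure ℝ)) :
    ‖rescale hc g‖ ≤ c * ‖g‖ :=
  norm_toLp_top_le _ (by positivity) (ae_norm_rescale_le hc g)

/-- The `j`-th entry of `𝓛 g`: it is `τ_{(0, δ_j)}` for `1 ≤ j ≤ N`, and `c g^{(k+1)}(c⁻¹ x)` for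
`j = kN + i` with `k ≥ 1` and `1 ≤ i ≤ N`, that is, with `k = (j - 1) / N`. -/
noncomputable def landscapeOperatorEntry (N : ℕ) {c : ℝ} (hc : 0 < c) (δ : ℕ → ℝ) (g : LInf)
    (j : ℕ+) : Lp ℝ ∞ (volume : Measure ℝ) :=
  if (j : ℕ) ≤ N then hatLp (δ j) else rescale hc (g (Nat.succPNat (((j : ℕ) - 1) / N)))

theorem memℓp_landscapeOperatorEntry (N : ℕ) {c : ℝ} (hc : 0 < c) (δ : ℕ → ℝ) (g : LInf) :
    Memℓp (landscapeOperatorEntry N hc δ g) ∞ := by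
  apply memℓp_infty
  refine ⟨∑ i ∈ Finset.range (N + 1), |δ i| + c * ‖g‖, ?_⟩
  rintro _ ⟨j, rfl⟩
  have h0 : 0 ≤ ∑ i ∈ Finset.range (N + 1), |δ i| := Finset.sum_nonneg fun _ _ => abs_nonneg _
  have h1 : 0 ≤ c * ‖g‖ := by positivity
  simp only [landscapeOperatorEntry]
  split_ifs with hj
  · have := Finset.single_le_sum (f := fun i => |δ i|) (fun _ _ => abs_nonneg _)
      (Finset.mem_range.2 (Nat.lt_succ_of_le hj))
    exact (norm_hatLp_le _).trans (by linarith)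
  · refine (norm_rescale_le hc _).trans ?_
    have := mul_le_mul_of_nonneg_left
      (lp.norm_apply_le_norm ENNReal.top_ne_zero g (Nat.succPNat (((j : ℕ) - 1) / N))) hc.le
    linarith

/-- The operator `𝓛 : L^∞(ℕ × ℝ) → L^∞(ℕ × ℝ)` with parameters `N`, `c` and `δ_1, …, δ_N`. -/
noncomputable def landscapeOperator (N : ℕ) {c : ℝ} (hc : 0 < c) (δ : ℕ → ℝ) (g : LInf) : LInf :=
  ⟨landscapeOperatorEntry N hc δ g, memℓp_landscapeOperatorEntry N hc δ g⟩

/-! ### Components of a compact set as classes of `ε`-chains -/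

section Components

variable {E : Type} [PseudoMetricSpace E]

/-! In a normed space two closed balls of radius `t / 2` meet exactly when their centres are at
distance at most `t`. So for `t ≥ 0` the rank of `H_0` is the number of classes of points of `A`
joined by steps of length at most `t` (`rank_homology_cechComplex`). Since `A` is compact, for `t >
0` these classes are the `t`-components (`setOf_isEpsComponent`).

All vertices are present from time `0`, so the maps on `H_0` between nonnegative times are
surjective. Before truncation sets in, the rank of such a map is therefore the component count at
its final time. Hence the `n`-th landscape function is the hat function of the `n`-th resolution for
every `n ≥ 1` (`cechLandscape_eq_hat`).

Self-similarity enters only through the resolutions. Below `c * diam A` no step leaves a piece `ψ i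
'' A`, so the count at `ε` is `N` times the count at `ε / c`; from `c * diam A` on, each piece lies
in one class and the count is at most `N`. This gives the recursion `resolution_rescale`, which is
the fixed-point equation for the sequence of hats, and its iteration gives the explicit formula. The
linear part of the operator has norm at most `c`, whence uniqueness and convergence. -/

/-- Two points of `A` at distance at most `ε`. -/
def CloseIn (A : Set E) (ε : ℝ) (x y : E) : Prop := x ∈ A ∧ y ∈ A ∧ dist x y ≤ ε

/-- The points that can be reached from `x` through `A` in steps of length at most `ε`. -/
def chainClass (A : Set E) (ε : ℝ) (x : E) : Set E :=
  {y | Relation.ReflTransGen (CloseIn A ε) x y}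

theorem setEDist_le_edist {Y Z : Set E} {y z : E} (hy : y ∈ Y) (hz : z ∈ Z) :
    setEDist Y Z ≤ edist y z :=
  (iInf₂_le y hy).trans (iInf₂_le z hz)

theorem setEDist_anti {Y Y' Z Z' : Set E} (hY : Y ⊆ Y') (hZ : Z ⊆ Z') :
    setEDist Y' Z' ≤ setEDist Y Z :=
  le_iInf₂ fun _ hy => le_iInf₂ fun _ hz => setEDist_le_edist (hY hy) (hZ hz)

theorem setEDist_comm (Y Z : Set E) : setEDist Y Z = setEDist Z Y :=
  le_antisymm
    (le_iInf₂ fun z hz => le_iInf₂ fun y hy => edist_comm y z ▸ setEDist_le_edist hy hz)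
    (le_iInf₂ fun y hy => le_iInf₂ fun z hz => edist_comm z y ▸ setEDist_le_edist hz hy)

theorem lt_dist_of_lt_setEDist {Y Z : Set E} {ε : ℝ} (h : ENNReal.ofReal ε < setEDist Y Z)
    {y z : E} (hy : y ∈ Y) (hz : z ∈ Z) : ε < dist y z := by
  have := h.trans_le (setEDist_le_edist hy hz)
  rw [edist_dist] at this
  exact (ENNReal.ofReal_lt_ofReal_iff'.1 this).1

theorem CloseIn.symm {A : Set E} {ε : ℝ} {x y : E} (h : CloseIn A ε x y) : CloseIn A ε y x :=
  ⟨h.2.1, h.1, dist_comm x y ▸ h.2.2⟩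

theorem CloseIn.mono {A : Set E} {ε ε' : ℝ} (hε : ε ≤ ε') {x y : E} (h : CloseIn A ε x y) :
    CloseIn A ε' x y :=
  ⟨h.1, h.2.1, h.2.2.trans hε⟩

theorem mem_chainClass_self (A : Set E) (ε : ℝ) (x : E) : x ∈ chainClass A ε x :=
  Relation.ReflTransGen.refl

theorem mem_chainClass_comm {A : Set E} {ε : ℝ} {x y : E} (h : y ∈ chainClass A ε x) :
    x ∈ chainClass A ε y :=
  by
  have : Std.Symm (CloseIn A ε) := ⟨fun _ _ => CloseIn.symm⟩
  exact Std.Symm.symm (r := Relation.ReflTransGen (CloseIn A ε)) _ _ h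

theorem chainClass_eq_of_mem {A : Set E} {ε : ℝ} {x y : E} (h : y ∈ chainClass A ε x) :
    chainClass A ε y = chainClass A ε x :=
  Set.Subset.antisymm (fun _ hz => Relation.ReflTransGen.trans h hz)
    (fun _ hz => Relation.ReflTransGen.trans (mem_chainClass_comm h) hz)

theorem chainClass_eq_of_closeIn {A : Set E} {ε : ℝ} {x y : E} (h : CloseIn A ε x y) :
    chainClass A ε y = chainClass A ε x :=
  chainClass_eq_of_mem (Relation.ReflTransGen.single h)

theorem chainClass_subset {A : Set E} {ε : ℝ} {x : E} (hx : x ∈ A) : chainClass A ε x ⊆ A := by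
  intro y hy
  induction hy with
  | refl => exact hx
  | tail _ h _ => exact h.2.1

theorem chainClass_mono {A : Set E} {ε ε' : ℝ} (hε : ε ≤ ε') (x : E) :
    chainClass A ε x ⊆ chainClass A ε' x :=
  fun _ hy => Relation.ReflTransGen.mono (fun _ _ => CloseIn.mono hε) _ _ hy

/-- A set that is closed under steps of length at most `ε` contains the class of its points. -/
theorem chainClass_subset_of_saturated {A B : Set E} {ε : ℝ}
    (hB : ∀ x ∈ B, ∀ y, CloseIn A ε x y → y ∈ B) {x : E} (hx : x ∈ B) : chainClass A ε x ⊆ B := by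
  intro y hy
  induction hy with
  | refl => exact hx
  | tail _ h ih => exact hB _ ih _ h

/-- A limit point of `B` lies in `A` and is within one step of a point of `B`. -/
theorem isClosed_of_saturated {A B : Set E} (hA : IsClosed A) {ε : ℝ} (hε : 0 < ε) (hBA : B ⊆ A)
    (hB : ∀ x ∈ B, ∀ y, CloseIn A ε x y → y ∈ B) : IsClosed B := by
  refine isClosed_of_closure_subset fun y hy => ?_
  have hyA : y ∈ A := hA.closure_subset_iff.2 hBA hy
  obtain ⟨b, hb, hyb⟩ := Metric.mem_closure_iff.1 hy ε hε
  exact hB b hb y ⟨hBA hb, hyA, by rw [dist_comm]; exact hyb.le⟩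

/-- Pointwise, distances between `B` and its complement exceed `ε`. Both sets are compact, so the
infimum is attained and the inequality stays strict; if one is empty the distance is infinite. -/
theorem lt_setEDist_of_saturated {A B : Set E} (hA : IsCompact A) (hA' : IsClosed A) {ε : ℝ}
    (hε : 0 < ε) (hBA : B ⊆ A) (hB : ∀ x ∈ B, ∀ y, CloseIn A ε x y → y ∈ B) :
    ENNReal.ofReal ε < setEDist B (A \ B) := by
  have hcB : IsClosed B := isClosed_of_saturated hA' hε hBA hB
  have hcC : IsClosed (A \ B) := by
    refine isClosed_of_saturated hA' hε Set.sdiff_subset fun x hx y hxy => ⟨hxy.2.1, fun hy => ?_⟩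
    exact hx.2 (hB y hy x hxy.symm)
  rcases (B ×ˢ (A \ B)).eq_empty_or_nonempty with h | h
  · refine lt_of_lt_of_le ENNReal.ofReal_lt_top (le_iInf₂ fun y hy => le_iInf₂ fun z hz => ?_)
    exact absurd (show (y, z) ∈ B ×ˢ (A \ B) from ⟨hy, hz⟩) (h ▸ Set.notMem_empty _)
  · obtain ⟨p, hp, hmin⟩ := ((hA.of_isClosed_subset hcB hBA).prod
      (hA.of_isClosed_subset hcC Set.sdiff_subset)).exists_isMinOn h
      (f := fun p : E × E => edist p.1 p.2) (by fun_prop)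
    have hlt : ε < dist p.1 p.2 := by
      by_contra hle
      exact hp.2.2 (hB _ hp.1 _ ⟨hBA hp.1, hp.2.1, not_lt.1 hle⟩)
    refine lt_of_lt_of_le ?_ (le_iInf₂ fun y hy => le_iInf₂ fun z hz =>
      hmin (show (y, z) ∈ B ×ˢ (A \ B) from ⟨hy, hz⟩))
    simp only [edist_dist]
    exact ENNReal.ofReal_lt_ofReal_iff'.2 ⟨hlt, hε.trans hlt⟩

theorem saturated_chainClass (A : Set E) (ε : ℝ) (x : E) :
    ∀ y ∈ chainClass A ε x, ∀ z, CloseIn A ε y z → z ∈ chainClass A ε x :=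
  fun _ hy _ hyz => Relation.ReflTransGen.tail hy hyz

/-- In a splitting with gap above `ε`, the part containing `x` is closed under steps and so exhausts
the class. -/
theorem epsConnected_chainClass {A : Set E} {ε : ℝ} (x : E) :
    EpsConnected (chainClass A ε x) ε := by
  have key : ∀ Y Z : Set E, chainClass A ε x = Y ∪ Z → ENNReal.ofReal ε < setEDist Y Z →
      x ∈ Y → ¬ Z.Nonempty := by
    rintro Y Z hYZ hd hx ⟨z, hz⟩
    have hsub : chainClass A ε x ⊆ chainClass A ε x ∩ Y := by
      refine chainClass_subset_of_saturated (fun y hy w hyw => ?_) ⟨mem_chainClass_self A ε x, hx⟩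
      have hw := saturated_chainClass A ε x y hy.1 w hyw
      refine ⟨hw, (hYZ ▸ hw : w ∈ Y ∪ Z).resolve_right fun hwZ => ?_⟩
      exact (lt_dist_of_lt_setEDist hd hy.2 hwZ).not_ge hyw.2.2
    have hzY : z ∈ Y := (hsub (hYZ ▸ Or.inr hz)).2
    have := hd.trans_le (setEDist_le_edist hzY hz)
    simp at this
  rintro ⟨Y, Z, hY, hZ, hYZ, hd⟩
  rcases (hYZ ▸ mem_chainClass_self A ε x : x ∈ Y ∪ Z) with hx | hx
  · exact key Y Z hYZ hd hx hZ
  · exact key Z Y (Set.union_comm Y Z ▸ hYZ) (setEDist_comm Y Z ▸ hd) hx hY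

/-- The `ε`-components of a compact set are its classes of `ε`-chains. -/
theorem setOf_isEpsComponent {A : Set E} (hA : IsCompact A) (hA' : IsClosed A) {ε : ℝ}
    (hε : 0 < ε) : {Y | IsEpsComponent A ε Y} = chainClass A ε '' A := by
  ext Y
  constructor
  · rintro ⟨hYA, ⟨x, hx⟩, hconn, hd⟩
    refine ⟨x, hYA hx, Set.Subset.antisymm ?_ ?_⟩
    · refine chainClass_subset_of_saturated (fun y hy z hyz => ?_) hx
      by_contra hz
      exact (lt_dist_of_lt_setEDist hd hy ⟨hyz.2.1, hz⟩).not_ge hyz.2.2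
    · by_contra hne
      obtain ⟨y, hy, hyx⟩ := Set.not_subset.1 hne
      have hsub : chainClass A ε x ⊆ Y := by
        refine chainClass_subset_of_saturated (fun y hy z hyz => ?_) hx
        by_contra hz
        exact (lt_dist_of_lt_setEDist hd hy ⟨hyz.2.1, hz⟩).not_ge hyz.2.2
      -- If the class of `x` were a proper subset of `Y`, it would split `Y` with gap above `ε`.
      refine hconn ⟨chainClass A ε x, Y \ chainClass A ε x, ⟨x, mem_chainClass_self A ε x⟩,
        ⟨y, hy, hyx⟩, (Set.union_sdiff_cancel hsub).symm, ?_⟩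
      exact (lt_setEDist_of_saturated hA hA' hε (chainClass_subset (hYA hx))
        (saturated_chainClass A ε x)).trans_le
        (setEDist_anti le_rfl (Set.sdiff_subset_sdiff_left hYA))
  · rintro ⟨x, hx, rfl⟩
    exact ⟨chainClass_subset hx, ⟨x, mem_chainClass_self A ε x⟩, epsConnected_chainClass x,
      lt_setEDist_of_saturated hA hA' hε (chainClass_subset hx) (saturated_chainClass A ε x)⟩

theorem epsComponentCount_eq {A : Set E} (hA : IsCompact A) (hA' : IsClosed A) {ε : ℝ}
    (hε : 0 < ε) : epsComponentCount A ε = (chainClass A ε '' A).encard := by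
  rw [epsComponentCount, setOf_isEpsComponent hA hA' hε]

/-- Enlarging each fine class to the coarse class containing it maps the fine classes onto the
coarse ones. -/
theorem encard_chainClass_anti (A : Set E) {ε ε' : ℝ} (h : ε ≤ ε') :
    (chainClass A ε' '' A).encard ≤ (chainClass A ε '' A).encard := by
  have : chainClass A ε' '' A =
      (fun Y : Set E => ⋃ y ∈ Y, chainClass A ε' y) '' (chainClass A ε '' A) := by
    rw [Set.image_image]
    refine Set.image_congr fun x _ => Set.Subset.antisymm ?_ ?_
    · exact Set.subset_biUnion_of_mem (u := chainClass A ε') (mem_chainClass_self A ε x)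
    · refine Set.iUnion₂_subset fun y hy => (chainClass_eq_of_mem ?_).subset
      exact chainClass_mono h x hy
  rw [this]
  exact Set.encard_image_le _ _

theorem encard_chainClass_le_one {A : Set E} (hA : Bornology.IsBounded A) {ε : ℝ}
    (h : Metric.diam A ≤ ε) : (chainClass A ε '' A).encard ≤ 1 := by
  rw [Set.encard_le_one_iff]
  rintro _ _ ⟨x, hx, rfl⟩ ⟨y, hy, rfl⟩
  exact chainClass_eq_of_closeIn ⟨hy, hx, (Metric.dist_le_diam_of_mem hA hy hx).trans h⟩

end Components

/-! ### Resolutions -/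

section Resolutions

variable {E : Type} [PseudoMetricSpace E]

theorem resolution_one (A : Set E) : resolution A 1 = Metric.diam A := if_pos rfl

theorem resolution_of_two_le (A : Set E) {k : ℕ} (hk : 2 ≤ k) : resolution A k =
    sInf {ε : ℝ | 0 < ε ∧ epsComponentCount A ε ≤ ((k - 1 : ℕ) : ℕ∞)} :=
  if_neg (by omega)

theorem resolution_nonneg (A : Set E) (k : ℕ) : 0 ≤ resolution A k := by
  unfold resolution
  split_ifs
  · exact Metric.diam_nonneg
  · exact Real.sInf_nonneg fun _ h => h.1.le

theorem bddBelow_resolutionSet (A : Set E) (n : ℕ∞) :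
    BddBelow {ε : ℝ | 0 < ε ∧ epsComponentCount A ε ≤ n} :=
  ⟨0, fun _ h => h.1.le⟩

theorem mem_resolutionSet_of_diam_le {A : Set E} (hA : IsCompact A) (hA' : IsClosed A) {ε : ℝ}
    (hε : 0 < ε) (h : Metric.diam A ≤ ε) {k : ℕ} (hk : 1 ≤ k) :
    epsComponentCount A ε ≤ (k : ℕ∞) := by
  rw [epsComponentCount_eq hA hA' hε]
  exact (encard_chainClass_le_one hA.isBounded h).trans (by exact_mod_cast hk)

theorem resolution_le_diam {A : Set E} (hA : IsCompact A) (hA' : IsClosed A) {k : ℕ}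
    (hk : 1 ≤ k) : resolution A k ≤ Metric.diam A := by
  rcases hk.eq_or_lt with rfl | hk
  · exact (resolution_one A).le
  · rw [resolution_of_two_le A hk]
    -- The diameter may be `0`, which is not an admissible scale, so it is approached from above.
    refine le_of_forall_gt_imp_ge_of_dense fun ε hε => ?_
    have h0 : 0 < ε := Metric.diam_nonneg.trans_lt hε
    exact csInf_le (bddBelow_resolutionSet A _)
      ⟨h0, mem_resolutionSet_of_diam_le hA hA' h0 hε.le (by omega)⟩

theorem le_count_of_lt_resolution {A : Set E} {n : ℕ} (hn : 2 ≤ n) {u : ℝ} (hu : 0 < u)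
    (h : u < resolution A n) : (n : ℕ∞) ≤ epsComponentCount A u := by
  rw [resolution_of_two_le A hn] at h
  by_contra hlt
  refine h.not_ge (csInf_le (bddBelow_resolutionSet A _) ⟨hu, ?_⟩)
  have : epsComponentCount A u < ((n - 1 : ℕ) : ℕ∞) + 1 := by
    have h1 : (((n - 1 : ℕ) : ℕ∞) + 1) = (n : ℕ∞) := by
      exact_mod_cast (show n - 1 + 1 = n by omega)
    rw [h1]
    exact not_le.1 hlt
  exact Order.le_of_lt_add_one this

theorem le_resolution_of_le_count {A : Set E} (hA : IsCompact A) (hA' : IsClosed A) {n : ℕ}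
    (hn : 2 ≤ n) {u : ℝ} (hu : 0 < u) (h : (n : ℕ∞) ≤ epsComponentCount A u) :
    u ≤ resolution A n := by
  rw [resolution_of_two_le A hn]
  -- The admissible set must be nonempty, as the infimum of the empty set is `0` by default; the
  -- added `1` keeps the witness positive when the diameter vanishes.
  refine le_csInf ⟨Metric.diam A + 1, ?_, ?_⟩ fun ε hε => ?_
  · exact add_pos_of_nonneg_of_pos Metric.diam_nonneg one_pos
  · exact mem_resolutionSet_of_diam_le hA hA' (add_pos_of_nonneg_of_pos Metric.diam_nonneg one_pos)
      (by linarith) (by omega)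
  · by_contra hlt
    have h1 := encard_chainClass_anti A (not_le.1 hlt).le
    rw [← epsComponentCount_eq hA hA' hε.1, ← epsComponentCount_eq hA hA' hu] at h1
    have h2 : ((n : ℕ) : ℕ∞) ≤ ((n - 1 : ℕ) : ℕ∞) := h.trans (h1.trans hε.2)
    have h3 : n ≤ n - 1 := by exact_mod_cast h2
    omega

end Resolutions

/-! ### Self-similarity of the components -/

section SelfSimilar

variable {E : Type} [PseudoMetricSpace E] {N : ℕ} {c : ℝ} {ψ : Fin N → E → E} {A : Set E}

theorem IsInvariantSet.image_mem (hA : IsInvariantSet ψ A) (i : Fin N) {x : E} (hx : x ∈ A) :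
    ψ i x ∈ A :=
  hA.eq_iUnion_image ▸ Set.mem_iUnion.2 ⟨i, x, hx, rfl⟩

theorem IsInvariantSet.exists_preimage (hA : IsInvariantSet ψ A) {x : E} (hx : x ∈ A) :
    ∃ i, ∃ y ∈ A, ψ i y = x :=
  Set.mem_iUnion.1 (hA.eq_iUnion_image ▸ hx : x ∈ ⋃ j, ψ j '' A)

/-- Exact scaling makes the diameter of a piece at least `c * diam A`, and distinct pieces are at
least such a diameter apart. -/
theorem mul_diam_le_dist (hc : 0 < c) (hψ : ∀ j x y, dist (ψ j x) (ψ j y) = c * dist x y)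
    (hA : IsInvariantSet ψ A) (hsep : WellSeparatedImages ψ A) {i j : Fin N} (hij : i ≠ j)
    {x y : E} (hx : x ∈ A) (hy : y ∈ A) : c * Metric.diam A ≤ dist (ψ i x) (ψ j y) := by
  have hb : Bornology.IsBounded (ψ i '' A) :=
    hA.isBounded.subset (Set.image_subset_iff.2 fun x hx => hA.image_mem i hx)
  have h1 : Metric.diam (ψ i '' A) ≤ dist (ψ i x) (ψ j y) := by
    have := (hsep i j hij i).trans (setEDist_le_edist (Set.mem_image_of_mem _ hx)
      (Set.mem_image_of_mem _ hy))
    rw [dist_edist]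
    exact ENNReal.toReal_mono (edist_ne_top _ _) this
  refine le_trans ?_ h1
  rw [← le_div_iff₀' hc]
  refine Metric.diam_le_of_forall_dist_le (div_nonneg Metric.diam_nonneg hc.le) fun x hx y hy => ?_
  rw [le_div_iff₀' hc, ← hψ i]
  exact Metric.dist_le_diam_of_mem hb (Set.mem_image_of_mem _ hx) (Set.mem_image_of_mem _ hy)

theorem closeIn_image (hc : 0 < c) (hψ : ∀ j x y, dist (ψ j x) (ψ j y) = c * dist x y)
    (hA : IsInvariantSet ψ A) {ε : ℝ} (i : Fin N) {x y : E} (h : CloseIn A (ε / c) x y) :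
    CloseIn A ε (ψ i x) (ψ i y) :=
  ⟨hA.image_mem i h.1, hA.image_mem i h.2.1, by
    rw [hψ, ← le_div_iff₀' hc]
    exact h.2.2⟩

/-- Distinct pieces are at least `c * diam A` apart, so a shorter step stays in its piece and pulls
back to a step of length at most `ε / c`. -/
theorem chainClass_image (hc : 0 < c) (hψ : ∀ j x y, dist (ψ j x) (ψ j y) = c * dist x y)
    (hA : IsInvariantSet ψ A) (hsep : WellSeparatedImages ψ A) {ε : ℝ}
    (hε : ε < c * Metric.diam A) (i : Fin N) {x : E} (hx : x ∈ A) :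
    chainClass A ε (ψ i x) = ψ i '' chainClass A (ε / c) x := by
  refine Set.Subset.antisymm ?_ ?_
  · refine chainClass_subset_of_saturated ?_ (Set.mem_image_of_mem _ (mem_chainClass_self _ _ x))
    rintro _ ⟨y, hy, rfl⟩ z hz
    have hyA := chainClass_subset hx hy
    obtain ⟨j, w, hw, rfl⟩ := hA.exists_preimage hz.2.1
    have hij : i = j := by
      by_contra hij
      exact (mul_diam_le_dist hc hψ hA hsep hij hyA hw).not_gt (hz.2.2.trans_lt hε)
    subst hij
    refine Set.mem_image_of_mem _ (saturated_chainClass A (ε / c) x y hy w ⟨hyA, hw, ?_⟩)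
    rw [le_div_iff₀' hc, ← hψ i]
    exact hz.2.2
  · rintro _ ⟨y, hy, rfl⟩
    exact Relation.ReflTransGen.lift (ψ i) (fun _ _ => closeIn_image hc hψ hA i) _ _ hy

/-- Classes at scale `ε` correspond bijectively to pairs of an index and a class at scale `ε / c`.
-/
theorem encard_chainClass_of_lt (hc : 0 < c)
    (hψ : ∀ j x y, dist (ψ j x) (ψ j y) = c * dist x y) (hinj : ∀ j, (ψ j).Injective)
    (hA : IsInvariantSet ψ A) (hsep : WellSeparatedImages ψ A) {ε : ℝ} (hε0 : 0 < ε)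
    (hε : ε < c * Metric.diam A) :
    (chainClass A ε '' A).encard = N * (chainClass A (ε / c) '' A).encard := by
  have himage : chainClass A ε '' A = (fun p : Fin N × Set E => ψ p.1 '' p.2) ''
      (Set.univ ×ˢ (chainClass A (ε / c) '' A)) := by
    ext Y
    constructor
    · rintro ⟨x, hx, rfl⟩
      obtain ⟨i, y, hy, rfl⟩ := hA.exists_preimage hx
      exact ⟨(i, chainClass A (ε / c) y), ⟨trivial, y, hy, rfl⟩,
        (chainClass_image hc hψ hA hsep hε i hy).symm⟩
    · rintro ⟨⟨i, _⟩, ⟨-, y, hy, rfl⟩, rfl⟩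
      exact ⟨ψ i y, hA.image_mem i hy, chainClass_image hc hψ hA hsep hε i hy⟩
  have hinjOn : Set.InjOn (fun p : Fin N × Set E => ψ p.1 '' p.2)
      (Set.univ ×ˢ (chainClass A (ε / c) '' A)) := by
    rintro ⟨i, _⟩ ⟨-, x, hx, rfl⟩ ⟨j, _⟩ ⟨-, y, hy, rfl⟩ h
    simp only at h
    have hij : i = j := by
      by_contra hij
      -- A point common to two different pieces would force `c * diam A ≤ 0`, against `0 < ε < c *
      -- diam A`.
      obtain ⟨z, hz, hzx⟩ : ψ i x ∈ ψ j '' chainClass A (ε / c) y :=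
        h ▸ Set.mem_image_of_mem _ (mem_chainClass_self _ _ x)
      have := mul_diam_le_dist hc hψ hA hsep hij hx (chainClass_subset hy hz)
      rw [hzx, dist_self] at this
      linarith
    subst hij
    rw [(hinj i).image_injective h]
  rw [himage, hinjOn.encard_image, Set.encard_prod, Set.encard_univ, ENat.card_eq_coe_fintype_card,
    Fintype.card_fin]

/-- Any two points of a piece are a single step apart, so the images of one base point represent all
classes. -/
theorem encard_chainClass_le_of_le (hψ : ∀ j x y, dist (ψ j x) (ψ j y) = c * dist x y)
    (hc : 0 < c) (hA : IsInvariantSet ψ A) {ε : ℝ} (hε : c * Metric.diam A ≤ ε) :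
    (chainClass A ε '' A).encard ≤ N := by
  obtain ⟨a, ha⟩ := hA.nonempty
  have hsub : chainClass A ε '' A ⊆ Set.range fun i => chainClass A ε (ψ i a) := by
    rintro _ ⟨x, hx, rfl⟩
    obtain ⟨i, y, hy, rfl⟩ := hA.exists_preimage hx
    refine ⟨i, chainClass_eq_of_closeIn (closeIn_image hc hψ hA i ⟨hy, ha, ?_⟩)⟩
    rw [le_div_iff₀' hc]
    exact (mul_le_mul_of_nonneg_left (Metric.dist_le_diam_of_mem hA.isBounded hy ha) hc.le).trans hε
  refine (Set.encard_le_encard hsub).trans ?_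
  rw [← Set.image_univ]
  refine (Set.encard_image_le _ _).trans ?_
  rw [Set.encard_univ, ENat.card_eq_coe_fintype_card, Fintype.card_fin]

theorem ENat.natCast_mul_le_natCast_iff {N : ℕ} (hN : 0 < N) (x : ℕ∞) (m : ℕ) :
    (N : ℕ∞) * x ≤ m ↔ x ≤ ((m / N : ℕ) : ℕ∞) := by
  induction x using ENat.recTopCoe with
  | top =>
    rw [ENat.mul_top (by exact_mod_cast hN.ne')]
    simp
  | coe x =>
    norm_cast
    rw [Nat.le_div_iff_mul_le hN, mul_comm]

/-- The resolutions beyond the `N`-th one are rescaled earlier ones. -/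
theorem resolution_rescale (hc : 0 < c)
    (hψ : ∀ j x y, dist (ψ j x) (ψ j y) = c * dist x y) (hinj : ∀ j, (ψ j).Injective)
    (hA : IsInvariantSet ψ A) (hcomp : IsCompact A) (hsep : WellSeparatedImages ψ A) {j : ℕ}
    (hN : 0 < N) (hj : N < j) : resolution A j = c * resolution A ((j - 1) / N + 1) := by
  have hk : 1 ≤ (j - 1) / N := (Nat.one_le_div_iff hN).2 (by omega)
  rw [resolution_of_two_le A (by omega), resolution_of_two_le A (by omega), ← smul_eq_mul,
    ← Real.sInf_smul_of_nonneg hc.le]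
  congr 1
  ext ε
  rw [Set.mem_smul_set_iff_inv_smul_mem₀ hc.ne', smul_eq_mul, inv_mul_eq_div]
  simp only [Set.mem_ofPred_eq, div_pos_iff_of_pos_right hc]
  refine and_congr_right fun hε => ?_
  have hεc : 0 < ε / c := div_pos hε hc
  rw [Nat.add_sub_cancel]
  rcases lt_or_ge ε (c * Metric.diam A) with h | h
  · rw [epsComponentCount_eq hcomp hA.isClosed hε, epsComponentCount_eq hcomp hA.isClosed hεc,
      encard_chainClass_of_lt hc hψ hinj hA hsep hε h, ENat.natCast_mul_le_natCast_iff hN]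
  -- Here both counts are small enough: the one at `ε` is at most `N ≤ j - 1`, and the one at `ε / c
  -- ≥ diam A` is at most `1`.
  · refine iff_of_true ?_ (mem_resolutionSet_of_diam_le hcomp hA.isClosed hεc ?_ hk)
    · rw [epsComponentCount_eq hcomp hA.isClosed hε]
      exact (encard_chainClass_le_of_le hψ hc hA h).trans (by exact_mod_cast (by omega))
    · rwa [le_div_iff₀' hc]

/-- The index map `j ↦ (j - 1) / N + 1` carries the block `((l - 1) * N ^ (k + 1), l * N ^ (k + 1)]`
into the block for `k`, and each application contributes a factor `c`. -/
theorem resolution_eq_pow_mul (hc : 0 < c)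
    (hψ : ∀ j x y, dist (ψ j x) (ψ j y) = c * dist x y) (hinj : ∀ j, (ψ j).Injective)
    (hA : IsInvariantSet ψ A) (hcomp : IsCompact A) (hsep : WellSeparatedImages ψ A) (hN : 0 < N)
    {l : ℕ} (hl : 2 ≤ l) (k : ℕ) {j : ℕ} (h1 : (l - 1) * N ^ k < j) (h2 : j ≤ l * N ^ k) :
    resolution A j = c ^ k * resolution A l := by
  induction k generalizing j with
  | zero =>
    rw [pow_zero, mul_one] at h1 h2
    rw [pow_zero, one_mul, show j = l by omega]
  | succ k ih =>
    -- As `l ≥ 2`, the whole block lies beyond the first `N` indices, where the recursion applies.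
    have hpow : N ≤ (l - 1) * N ^ (k + 1) :=
      (Nat.le_self_pow (Nat.succ_ne_zero k) N).trans (Nat.le_mul_of_pos_left _ (by omega))
    rw [resolution_rescale hc hψ hinj hA hcomp hsep hN (hpow.trans_lt h1), ih, pow_succ']
    · ring
    · rw [Nat.lt_succ_iff, Nat.le_div_iff_mul_le hN, mul_assoc, ← pow_succ]
      omega
    · rw [Nat.succ_le_iff, Nat.div_lt_iff_lt_mul hN, mul_assoc, ← pow_succ]
      omega

end SelfSimilar

/-! ### Zeroth homology of the Čech complex -/

section Chains

open SimplicialHomology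

variable {E : Type}

open Classical in
theorem boundary_single_pair {x y : E} (hxy : x ≠ y) :
    boundary (Finsupp.single ({x, y} : Finset E) 1) =
      Finsupp.single {y} (1 : ZMod 2) + Finsupp.single {x} 1 := by
  rw [boundary, Finsupp.linearCombination_single, one_smul, Finset.sum_pair hxy]
  congr 2
  · simp [Finset.erase_insert_eq_erase, Finset.erase_eq_of_notMem, hxy]
  · rw [Finset.pair_comm]
    simp [Finset.erase_insert_eq_erase, Finset.erase_eq_of_notMem, hxy.symm]

open Classical in
/-- The parity of the number of vertices in `Y` of a chain. -/
noncomputable def vertexParity (Y : Set E) : FormalChains E →ₗ[ZMod 2] ZMod 2 :=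
  Finsupp.linearCombination (ZMod 2) fun σ => if ∃ x ∈ Y, σ = {x} then 1 else 0

open Classical in
theorem vertexParity_single (Y : Set E) (x : E) :
    vertexParity Y (Finsupp.single {x} 1) = if x ∈ Y then 1 else 0 := by
  simp [vertexParity]

end Chains

/-! ### Vertex classes and the trivial ranges of the truncated module -/

section CechMetric

open SimplicialHomology

variable {E : Type} [PseudoMetricSpace E] {A : Set E} {t : ℝ}

theorem singleton_mem_cechComplex (ht : 0 ≤ t) {x : E} (hx : x ∈ A) :
    ({x} : Finset E) ∈ cechComplex A t := by
  refine ⟨Finset.singleton_nonempty x, by simpa using hx, x, ?_⟩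
  simpa using by linarith

theorem singleton_mem_cycles (ht : 0 ≤ t) {x : E} (hx : x ∈ A) :
    Finsupp.single ({x} : Finset E) (1 : ZMod 2) ∈ cycles (cechComplex A t) 0 :=
  Finsupp.single_mem_supported _ _ ⟨singleton_mem_cechComplex ht hx, Finset.card_singleton x⟩

/-- The homology class of a vertex. -/
noncomputable def vertexClass (ht : 0 ≤ t) (x : A) : Homology (cechComplex A t) 0 :=
  Submodule.Quotient.mk ⟨Finsupp.single {(x : E)} 1, singleton_mem_cycles ht x.2⟩

theorem span_range_vertexClass (ht : 0 ≤ t) :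
    Submodule.span (ZMod 2) (Set.range (vertexClass (A := A) ht)) = ⊤ := by
  rw [eq_top_iff]
  rintro z -
  obtain ⟨⟨w, hw⟩, rfl⟩ := Submodule.Quotient.mk_surjective _ z
  have hw' := hw
  change w ∈ Finsupp.supported _ _ _ at hw'
  rw [Finsupp.supported_eq_span_single] at hw'
  induction hw' using Submodule.span_induction with
  | mem v hv =>
    obtain ⟨σ, ⟨hσ, hcard⟩, rfl⟩ := hv
    obtain ⟨x, rfl⟩ := Finset.card_eq_one.1 hcard
    exact Submodule.subset_span ⟨⟨x, hσ.2.1 (by simp)⟩, rfl⟩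
  | zero => exact Submodule.zero_mem _
  | add u v hu hv ihu ihv =>
    rw [← Finsupp.supported_eq_span_single] at hu hv
    exact Submodule.add_mem _ (ihu hu) (ihv hv)
  | smul a u hu ihu =>
    rw [← Finsupp.supported_eq_span_single] at hu
    exact Submodule.smul_mem _ a (ihu hu)

/-- The vertex classes generate the target, and each of them already exists at time `s ≥ 0`. -/
theorem homologyMap_zero_surjective (A : Set E) {s : ℝ} (hs : 0 ≤ s) (hst : s ≤ t) :
    Function.Surjective (homologyMap (cechComplex_mono A hst) 0) := by
  rw [← LinearMap.range_eq_top, eq_top_iff, ← span_range_vertexClass (hs.trans hst),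
    Submodule.span_le]
  rintro _ ⟨x, rfl⟩
  exact ⟨vertexClass hs x, rfl⟩

theorem mem_chainClass_iff_of_closeIn (z x y : E) (h : CloseIn A t x y) :
    x ∈ chainClass A t z ↔ y ∈ chainClass A t z :=
  ⟨fun hx => saturated_chainClass A t z x hx y h,
    fun hy => saturated_chainClass A t z y hy x h.symm⟩

theorem subsingleton_homology_of_neg (A : Set E) (ht : t < 0) :
    Subsingleton (Homology (cechComplex A t) 0) := by
  have h : ∀ z : Homology (cechComplex A t) 0, z = 0 := by
    intro z
    obtain ⟨⟨w, hw⟩, rfl⟩ := Submodule.Quotient.mk_surjective _ z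
    have hempty : {σ : Finset E | σ ∈ cechComplex A t ∧ σ.card = 0 + 1} = ∅ := by
      refine Set.eq_empty_of_forall_notMem ?_
      rintro σ ⟨⟨⟨x, hx⟩, -, y, hy⟩, -⟩
      have := Set.mem_iInter₂.1 hy x hx
      rw [Metric.closedBall_eq_empty.2 (by linarith)] at this
      exact this
    have hw' : w ∈ Finsupp.supported (ZMod 2) (ZMod 2)
      {σ : Finset E | σ ∈ cechComplex A t ∧ σ.card = 0 + 1} := hw
    rw [hempty, Finsupp.supported_empty, Submodule.mem_bot] at hw'
    subst hw'
    rfl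
  exact ⟨fun x y => (h x).trans (h y).symm⟩

theorem rank_truncate_cechModule_of_neg {s t T : ℝ} (hst : s ≤ t) (hs : s < 0) :
    LinearMap.rank (((cechModule A 0).truncate T).map hst) = 0 := by
  have : Subsingleton ((cechModule A 0).V s) := subsingleton_homology_of_neg A hs
  have : Subsingleton (((cechModule A 0).truncate T).V s) :=
    (Submodule.Quotient.mk_surjective ((cechModule A 0).cut T s)).subsingleton
  have hzero : ((cechModule A 0).truncate T).map hst = 0 := by
    ext z
    rw [Subsingleton.elim z 0, map_zero, map_zero]
  rw [hzero, LinearMap.rank_zero]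

theorem rank_truncate_cechModule_of_le {s t T : ℝ} (hst : s ≤ t) (ht : T ≤ t) :
    LinearMap.rank (((cechModule A 0).truncate T).map hst) = 0 := by
  have htop : (cechModule A 0).cut T t = ⊤ := by
    rw [PersistenceModule.cut, if_neg ht.not_gt]
  have : Subsingleton (((cechModule A 0).truncate T).V t) :=
    Submodule.Quotient.subsingleton_iff.2 htop
  have hzero : ((cechModule A 0).truncate T).map hst = 0 := by
    ext z
    exact Subsingleton.elim _ _
  rw [hzero, LinearMap.rank_zero]

end CechMetric

/-! ### The rank of zeroth homology -/

section ZerothHomology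

open SimplicialHomology

variable {E : Type} [NormedAddCommGroup E] [NormedSpace ℝ E] {A : Set E} {t : ℝ}

open Classical in
-- The midpoint of `x` and `y` is the common point of the two balls; this is where the linear
-- structure is needed.
theorem pair_mem_cechComplex_iff {x y : E} :
    ({x, y} : Finset E) ∈ cechComplex A t ↔ CloseIn A t x y := by
  constructor
  · rintro ⟨-, hA, z, hz⟩
    simp only [Finset.mem_insert, Finset.mem_singleton, Set.iInter_iInter_eq_or_left,
      Set.iInter_iInter_eq_left, Set.mem_inter_iff, Metric.mem_closedBall] at hz
    refine ⟨hA (by simp), hA (by simp), ?_⟩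
    linarith [dist_triangle_left x y z]
  · rintro ⟨hx, hy, h⟩
    refine ⟨by simp, by simp [Set.insert_subset_iff, hx, hy], midpoint ℝ x y, ?_⟩
    simp only [Finset.mem_insert, Finset.mem_singleton, Set.iInter_iInter_eq_or_left,
      Set.iInter_iInter_eq_left, Set.mem_inter_iff, Metric.mem_closedBall, dist_midpoint_left,
      dist_midpoint_right]
    norm_num
    linarith

theorem vertexClass_eq_of_closeIn (ht : 0 ≤ t) {x y : A} (h : CloseIn A t x y) :
    vertexClass ht x = vertexClass ht y := by
  classical
  -- When the points coincide, `{x, y}` is a vertex rather than an edge, so it cannot bound the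
  -- difference.
  by_cases hxy : (x : E) = y
  · rw [Subtype.ext hxy]
  · refine (Submodule.Quotient.eq _).2 ?_
    change _ ∈ boundaries (cechComplex A t) 0
    refine ⟨Finsupp.single {(x : E), (y : E)} 1, Finsupp.single_mem_supported _ _
      ⟨pair_mem_cechComplex_iff.2 h, Finset.card_pair hxy⟩, ?_⟩
    rw [boundary_single_pair hxy]
    change _ = Finsupp.single {(x : E)} (1 : ZMod 2) - Finsupp.single {(y : E)} 1
    rw [ZModModule.sub_eq_add, add_comm]

theorem vertexClass_eq_of_mem_chainClass (ht : 0 ≤ t) {x y : A}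
    (h : (y : E) ∈ chainClass A t x) : vertexClass ht x = vertexClass ht y := by
  have key : ∀ z ∈ chainClass A t x, ∃ hz : z ∈ A, vertexClass ht x = vertexClass ht ⟨z, hz⟩ := by
    intro z hz
    induction hz with
    | refl => exact ⟨x.2, rfl⟩
    | tail _ h ih =>
      obtain ⟨hz, ih⟩ := ih
      exact ⟨h.2.1, ih.trans (vertexClass_eq_of_closeIn ht h)⟩
  exact (key y h).2

/-- Each edge has both endpoints in `Y` or neither, hence contributes `0` modulo `2`. -/
theorem vertexParity_of_mem_boundaries {Y : Set E}
    (hY : ∀ x y, CloseIn A t x y → (x ∈ Y ↔ y ∈ Y)) {w : FormalChains E}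
    (hw : w ∈ boundaries (cechComplex A t) 0) : vertexParity Y w = 0 := by
  classical
  obtain ⟨v, hv, rfl⟩ := hw
  change v ∈ Finsupp.supported _ _ _ at hv
  rw [Finsupp.supported_eq_span_single] at hv
  induction hv using Submodule.span_induction with
  | mem v hv =>
    obtain ⟨σ, ⟨hσ, hcard⟩, rfl⟩ := hv
    obtain ⟨x, y, hxy, rfl⟩ := Finset.card_eq_two.1 hcard
    change vertexParity Y (boundary (Finsupp.single {x, y} 1)) = 0
    rw [boundary_single_pair hxy, map_add, vertexParity_single, vertexParity_single,
      if_congr (hY x y (pair_mem_cechComplex_iff.1 hσ)) rfl rfl, ZModModule.add_self]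
  | zero => simp
  | add u v _ _ hu hv => rw [map_add, map_add, hu, hv, add_zero]
  | smul a u _ hu => rw [map_smul, map_smul, hu, smul_zero]

/-- The parity of the number of vertices in a union `Y` of components, on homology. -/
noncomputable def homologyParity {Y : Set E}
    (hY : ∀ x y, CloseIn A t x y → (x ∈ Y ↔ y ∈ Y)) :
    Homology (cechComplex A t) 0 →ₗ[ZMod 2] ZMod 2 :=
  Submodule.liftQ _ (vertexParity Y ∘ₗ (cycles (cechComplex A t) 0).subtype)
    fun _ hw => vertexParity_of_mem_boundaries hY hw

open Classical in
theorem homologyParity_vertexClass {Y : Set E}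
    (hY : ∀ x y, CloseIn A t x y → (x ∈ Y ↔ y ∈ Y)) (ht : 0 ≤ t) (x : A) :
    homologyParity hY (vertexClass ht x) = if (x : E) ∈ Y then 1 else 0 :=
  vertexParity_single Y x

/-- One representative vertex per class gives a basis: chains identify every vertex with its
representative, and the parity functionals of the classes are dual to the representatives. -/
theorem rank_homology_cechComplex (A : Set E) (ht : 0 ≤ t) :
    Module.rank (ZMod 2) (Homology (cechComplex A t) 0) = Cardinal.mk (chainClass A t '' A) := by
  classical
  choose r hrA hr using fun Y : chainClass A t '' A => Y.2
  let b : chainClass A t '' A → Homology (cechComplex A t) 0 :=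
    fun Y => vertexClass ht ⟨r Y, hrA Y⟩
  have hli : LinearIndependent (ZMod 2) b := by
    refine LinearIndependent.of_comp (LinearMap.pi fun Y : chainClass A t '' A =>
      homologyParity (mem_chainClass_iff_of_closeIn (A := A) (t := t) (r Y))) ?_
    suffices h : ∀ Z : chainClass A t '' A, (LinearMap.pi fun Y : chainClass A t '' A =>
        homologyParity (mem_chainClass_iff_of_closeIn (A := A) (t := t) (r Y))) (b Z) =
          Pi.single Z 1 from
      (funext h : _ ∘ b = _) ▸ Pi.linearIndependent_single_one (chainClass A t '' A) (ZMod 2)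
    intro Z
    funext Y
    simp only [LinearMap.pi_apply, b, homologyParity_vertexClass,
      Pi.single_apply]
    refine if_congr ⟨fun h => ?_, fun h => h ▸ mem_chainClass_self _ _ _⟩ rfl rfl
    exact Subtype.ext (by rw [← hr Y, ← hr Z, chainClass_eq_of_mem h])
  have hspan : ⊤ ≤ Submodule.span (ZMod 2) (Set.range b) := by
    rw [← span_range_vertexClass (A := A) ht]
    refine Submodule.span_mono ?_
    rintro _ ⟨x, rfl⟩
    let Y : chainClass A t '' A := ⟨chainClass A t x, x, x.2, rfl⟩
    refine ⟨Y, vertexClass_eq_of_mem_chainClass ht ?_⟩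
    change (x : E) ∈ chainClass A t (r Y)
    rw [hr Y]
    exact mem_chainClass_self _ _ _
  exact (Module.Basis.mk hli hspan).mk_eq_rank''.symm

end ZerothHomology

/-! ### The landscape of a compact set -/

section Landscape

variable {E : Type} [NormedAddCommGroup E] [NormedSpace ℝ E] {A : Set E}

theorem rank_truncate_cechModule {s t T : ℝ} (hst : s ≤ t) (hs : 0 ≤ s) (ht : t < T) :
    LinearMap.rank (((cechModule A 0).truncate T).map hst) =
      Cardinal.mk (chainClass A t '' A) := by
  have hsurj : Function.Surjective (((cechModule A 0).truncate T).map hst) := by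
    intro z
    obtain ⟨w, rfl⟩ := Submodule.Quotient.mk_surjective _ z
    obtain ⟨v, rfl⟩ := homologyMap_zero_surjective A hs hst w
    exact ⟨Submodule.Quotient.mk v, rfl⟩
  have hbot : (cechModule A 0).cut T t = ⊥ := by
    rw [PersistenceModule.cut, if_pos ht]
  -- By surjectivity the rank is the dimension of the target, which truncation leaves unchanged
  -- before `T`.
  rw [LinearMap.rank, rank_range_of_surjective _ hsurj,
    ← rank_homology_cechComplex A (hs.trans hst)]
  exact (Submodule.quotEquivOfEqBot _ hbot).rank_eq

theorem natCast_le_rank_truncate_cechModule_iff (hA : IsCompact A) {n : ℕ} (hn : 1 ≤ n)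
    {s t T : ℝ} (hst : s ≤ t) (ht : 0 < t) :
    (n : Cardinal) ≤ LinearMap.rank (((cechModule A 0).truncate T).map hst) ↔
      0 ≤ s ∧ t < T ∧ (n : ℕ∞) ≤ epsComponentCount A t := by
  have hn0 : ¬ (n : Cardinal) ≤ 0 := by
    rw [nonpos_iff_eq_zero]
    exact_mod_cast (by omega : n ≠ 0)
  rcases lt_or_ge s 0 with hs | hs
  · rw [rank_truncate_cechModule_of_neg hst hs]
    exact iff_of_false hn0 fun h => h.1.not_gt hs
  rcases lt_or_ge t T with htT | htT
  · rw [rank_truncate_cechModule hst hs htT, epsComponentCount_eq hA hA.isClosed ht,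
      ← Cardinal.natCast_le_toENat]
    exact ⟨fun h => ⟨hs, htT, h⟩, fun h => h.2.2⟩
  · rw [rank_truncate_cechModule_of_le hst htT]
    exact iff_of_false hn0 fun h => h.2.1.not_ge htT

theorem le_hat {b t m : ℝ} (h1 : m ≤ t) (h2 : t + m ≤ b) : m ≤ hat b t :=
  le_max_of_le_right (le_min h1 (by linarith))

/-- Every entry of the landscape of a nonempty compact set is the hat function of the
corresponding resolution. -/
theorem cechLandscape_eq_hat (hA : IsCompact A) (hne : A.Nonempty) {n : ℕ} (hn : 1 ≤ n) (t : ℝ) :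
    cechLandscape A n t = ENNReal.ofReal (hat (resolution A n) t) := by
  apply le_antisymm
  · refine iSup₂_le fun m hm => ?_
    rw [← ENNReal.ofReal_coe_nnreal]
    rcases lt_or_ge 0 (t + m) with hpos | hneg
    · obtain ⟨h1, h2, h3⟩ := (natCast_le_rank_truncate_cechModule_iff hA hn _ hpos).1 hm
      refine ENNReal.ofReal_le_ofReal (le_hat (by linarith) ?_)
      rcases hn.eq_or_lt with rfl | hn
      · exact (resolution_one A).symm ▸ h2.le
      · exact le_resolution_of_le_count hA hA.isClosed hn hpos h3
    -- With `t + m ≤ 0`, a negative birth time gives rank `0 < n`; otherwise `m ≤ t ≤ -m` forces `m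
    -- = 0`.
    · rcases lt_or_ge (t - m) 0 with hs | hs
      · rw [rank_truncate_cechModule_of_neg _ hs, nonpos_iff_eq_zero] at hm
        exact absurd hm (by exact_mod_cast (by omega : n ≠ 0))
      · refine ENNReal.ofReal_le_ofReal (le_trans ?_ (le_max_left _ _))
        linarith
  · refine le_of_forall_lt fun a ha => ?_
    -- Staying strictly below the hat gives `t + m < resolution A n`, where the count is still at
    -- least `n`; at the resolution itself it may have dropped.
    obtain ⟨m, hm, hma⟩ : ∃ m : ℝ≥0, a < m ∧ (m : ℝ) < hat (resolution A n) t := by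
      obtain ⟨m, h1, h2⟩ := ENNReal.lt_iff_exists_nnreal_btwn.1 ha
      refine ⟨m, h1, ?_⟩
      rw [← ENNReal.ofReal_coe_nnreal, ENNReal.ofReal_lt_ofReal_iff'] at h2
      exact h2.1
    refine hm.trans_le (le_iSup₂_of_le m ?_ le_rfl)
    have hm' : (m : ℝ) < min t (resolution A n - t) :=
      (lt_max_iff.1 hma).resolve_left m.coe_nonneg.not_gt
    obtain ⟨h1, h2⟩ := lt_min_iff.1 hm'
    have hpos : 0 < t + m := by linarith [m.coe_nonneg]
    refine (natCast_le_rank_truncate_cechModule_iff hA hn _ hpos).2 ⟨by linarith, ?_, ?_⟩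
    -- No resolution exceeds the diameter, so truncation does not interfere.
    · linarith [resolution_le_diam hA hA.isClosed hn]
    · rcases hn.eq_or_lt with rfl | hn
      · rw [epsComponentCount_eq hA hA.isClosed hpos, Nat.cast_one, Set.one_le_encard_iff_nonempty]
        exact hne.image _
      · exact le_count_of_lt_resolution hn hpos (by linarith)

end Landscape

/-! ### The landscape operator -/

section Operator

theorem hatLp_zero : hatLp 0 = 0 := by
  rw [← norm_le_zero_iff]
  simpa using norm_hatLp_le 0

theorem coeFn_rescale {c : ℝ} (hc : 0 < c) (g : Lp ℝ ∞ (volume : Measure ℝ)) :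
    rescale hc g =ᵐ[volume] fun x => c * g (c⁻¹ * x) :=
  MemLp.coeFn_toLp _

theorem rescale_add {c : ℝ} (hc : 0 < c) (g h : Lp ℝ ∞ (volume : Measure ℝ)) :
    rescale hc (g + h) = rescale hc g + rescale hc h := by
  apply Lp.ext
  filter_upwards [coeFn_rescale hc (g + h), coeFn_rescale hc g, coeFn_rescale hc h,
    Lp.coeFn_add (rescale hc g) (rescale hc h),
    (quasiMeasurePreserving_inv_mul hc).ae (Lp.coeFn_add g h)] with x h1 h2 h3 h4 h5
  rw [h1, h4, Pi.add_apply, h2, h3, h5, Pi.add_apply, mul_add]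

theorem rescale_smul {c : ℝ} (hc : 0 < c) (a : ℝ) (g : Lp ℝ ∞ (volume : Measure ℝ)) :
    rescale hc (a • g) = a • rescale hc g := by
  apply Lp.ext
  filter_upwards [coeFn_rescale hc (a • g), coeFn_rescale hc g,
    Lp.coeFn_smul a (rescale hc g),
    (quasiMeasurePreserving_inv_mul hc).ae (Lp.coeFn_smul a g)] with x h1 h2 h4 h5
  rw [h1, h4, Pi.smul_apply, h2, h5, Pi.smul_apply, smul_eq_mul, smul_eq_mul]
  ring

theorem rescale_zero {c : ℝ} (hc : 0 < c) : rescale hc 0 = 0 := by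
  simpa using rescale_smul hc 0 0

theorem hat_mul {c : ℝ} (hc : 0 < c) (b t : ℝ) : hat (c * b) t = c * hat b (c⁻¹ * t) := by
  unfold hat
  rw [mul_max_of_nonneg _ _ hc.le, mul_min_of_nonneg _ _ hc.le, mul_sub, mul_zero,
    mul_inv_cancel_left₀ hc.ne']

theorem coeFn_hatLp (b : ℝ) : hatLp b =ᵐ[volume] hat b := MemLp.coeFn_toLp _

theorem rescale_hatLp {c : ℝ} (hc : 0 < c) (b : ℝ) : rescale hc (hatLp b) = hatLp (c * b) := by
  apply Lp.ext
  filter_upwards [coeFn_rescale hc (hatLp b), coeFn_hatLp (c * b),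
    (quasiMeasurePreserving_inv_mul hc).ae (coeFn_hatLp b)] with x h1 h2 h3
  rw [h1, h2, h3, hat_mul hc]

theorem landscapeOperator_apply (N : ℕ) {c : ℝ} (hc : 0 < c) (δ : ℕ → ℝ) (g : LInf) (j : ℕ+) :
    landscapeOperator N hc δ g j = if (j : ℕ) ≤ N then hatLp (δ j)
      else rescale hc (g (Nat.succPNat (((j : ℕ) - 1) / N))) := rfl

/-- The linear part of the landscape operator. -/
noncomputable def landscapeLinear (N : ℕ) {c : ℝ} (hc : 0 < c) : LInf →L[ℝ] LInf :=
  LinearMap.mkContinuous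
    -- With all resolutions `0` the constant entries vanish, leaving the linear part.
    { toFun := landscapeOperator N hc 0
      map_add' := fun g h => by
        ext1
        funext j
        rw [lp.coeFn_add, Pi.add_apply]
        simp only [landscapeOperator_apply, Pi.zero_apply, hatLp_zero]
        split_ifs
        · rw [add_zero]
        · rw [lp.coeFn_add, Pi.add_apply, rescale_add]
      map_smul' := fun a g => by
        ext1
        funext j
        rw [lp.coeFn_smul, Pi.smul_apply]
        simp only [landscapeOperator_apply, Pi.zero_apply, hatLp_zero, RingHom.id_apply]
        split_ifs
        · rw [smul_zero]
        · rw [lp.coeFn_smul, Pi.smul_apply, rescale_smul] }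
    c fun g => by
      refine lp.norm_le_of_forall_le (by positivity) fun j => ?_
      simp only [LinearMap.coe_mk, AddHom.coe_mk, landscapeOperator_apply, Pi.zero_apply,
        hatLp_zero]
      split_ifs
      · rw [norm_zero]
        positivity
      · exact (norm_rescale_le hc _).trans
          (mul_le_mul_of_nonneg_left (lp.norm_apply_le_norm ENNReal.top_ne_zero g _) hc.le)

theorem landscapeLinear_apply (N : ℕ) {c : ℝ} (hc : 0 < c) (g : LInf) :
    landscapeLinear N hc g = landscapeOperator N hc 0 g := rfl

theorem norm_landscapeLinear_le (N : ℕ) {c : ℝ} (hc : 0 < c) : ‖landscapeLinear N hc‖ ≤ c :=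
  LinearMap.mkContinuous_norm_le _ hc.le _

theorem landscapeOperator_eq_add (N : ℕ) {c : ℝ} (hc : 0 < c) (δ : ℕ → ℝ) (g : LInf) :
    landscapeOperator N hc δ g = landscapeOperator N hc δ 0 + landscapeLinear N hc g := by
  ext1
  funext j
  rw [lp.coeFn_add, Pi.add_apply, landscapeLinear_apply]
  simp only [landscapeOperator_apply, Pi.zero_apply, hatLp_zero]
  split_ifs
  · rw [add_zero]
  · rw [lp.coeFn_zero, Pi.zero_apply, rescale_zero, zero_add]

theorem contractingWith_landscapeOperator (N : ℕ) {c : ℝ} (hc : 0 < c) (hc1 : c < 1)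
    (δ : ℕ → ℝ) : ContractingWith c.toNNReal (landscapeOperator N hc δ) := by
  refine ⟨Real.toNNReal_lt_one.2 hc1, LipschitzWith.of_dist_le_mul fun g h => ?_⟩
  rw [landscapeOperator_eq_add N hc δ g, landscapeOperator_eq_add N hc δ h, dist_add_left,
    dist_eq_norm, dist_eq_norm, ← map_sub, Real.coe_toNNReal _ hc.le]
  exact (landscapeLinear N hc).le_of_opNorm_le (norm_landscapeLinear_le N hc) _

/-- The bounded sequence of the hat functions `τ_{(0, b_j)}`. -/
noncomputable def hatSeq (b : ℕ → ℝ) {C : ℝ} (hb : ∀ j, 1 ≤ j → |b j| ≤ C) : LInf :=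
  ⟨fun j : ℕ+ => hatLp (b j), memℓp_infty ⟨C, by
    rintro _ ⟨j, rfl⟩
    exact (norm_hatLp_le _).trans (hb j j.pos)⟩⟩

/-- Rescaling turns the hat of `b` into the hat of `c * b`, so the recursion for the endpoints is
exactly the fixed-point equation. -/
theorem landscapeOperator_hatSeq {N : ℕ} {c : ℝ} (hc : 0 < c) {b : ℕ → ℝ} {C : ℝ}
    (hb : ∀ j, 1 ≤ j → |b j| ≤ C) (hrec : ∀ j, N < j → b j = c * b ((j - 1) / N + 1)) :
    landscapeOperator N hc b (hatSeq b hb) = hatSeq b hb := by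
  ext1
  funext j
  rw [landscapeOperator_apply]
  split_ifs with hj
  · rfl
  · change rescale hc (hatLp (b (Nat.succPNat (((j : ℕ) - 1) / N)))) = hatLp (b j)
    rw [rescale_hatLp, Nat.succPNat_coe, Nat.succ_eq_add_one, ← hrec j (not_le.1 hj)]

/-- The `n`-th iterate is `K ^ n`-Lipschitz and fixes `x`. The fixed point is given explicitly, so
completeness plays no role. -/
theorem ContractingWith.tendsto_iterate_of_isFixedPt {α : Type*} [MetricSpace α] {K : ℝ≥0}
    {F : α → α} (hF : ContractingWith K F) {x : α} (hx : F x = x) (y : α) :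
    Filter.Tendsto (fun n : ℕ => F^[n] y) Filter.atTop (nhds x) := by
  rw [tendsto_iff_dist_tendsto_zero]
  have hlim : Filter.Tendsto (fun n : ℕ => (K : ℝ) ^ n * dist y x) Filter.atTop (nhds 0) := by
    simpa using (tendsto_pow_atTop_nhds_zero_of_lt_one K.coe_nonneg
      (show (K : ℝ) < 1 from hF.1)).mul_const (dist y x)
  refine squeeze_zero (fun _ => dist_nonneg) (fun n => ?_) hlim
  have := (hF.2.iterate n).dist_le_mul y x
  rwa [Function.iterate_fixed hx, NNReal.coe_pow] at this

end Operator

theorem mainTheorem1 (d N : ℕ) (c : ℝ) (hc0 : 0 < c) (hc1 : c < 1)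
    (ψ : Fin N → EuclideanSpace ℝ (Fin d) → EuclideanSpace ℝ (Fin d))
    (hψ : ∀ j x y, dist (ψ j x) (ψ j y) = c * dist x y)
    (A : Set (EuclideanSpace ℝ (Fin d))) (hA : IsInvariantSet ψ A)
    (hsep : WellSeparatedImages ψ A) :
    -- the operator is affine and a contraction with constant `c`
    (∃ T : LInf →L[ℝ] LInf, ∀ g : LInf, landscapeOperator N hc0 (resolution A) g =
      landscapeOperator N hc0 (resolution A) 0 + T g) ∧
    ContractingWith c.toNNReal (landscapeOperator N hc0 (resolution A)) ∧
    -- the landscape is finite, belongs to `L^∞(ℕ × ℝ)`, and is the unique fixed point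
    (∀ (j : ℕ+) (t : ℝ), cechLandscape A j t ≠ ∞) ∧
    (∃ f : LInf, (∀ j : ℕ+, f j =ᵐ[volume] fun t : ℝ => (cechLandscape A j t).toReal) ∧
      landscapeOperator N hc0 (resolution A) f = f ∧
      (∀ g : LInf, landscapeOperator N hc0 (resolution A) g = g → g = f) ∧
      ∀ g : LInf, Filter.Tendsto (fun n : ℕ => (landscapeOperator N hc0 (resolution A))^[n] g)
        Filter.atTop (nhds f)) ∧
    -- the explicit formula for the landscape
    (∀ (j : ℕ) (t : ℝ), 1 ≤ j → j ≤ N →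
      cechLandscape A j t = ENNReal.ofReal (hat (resolution A j) t)) ∧
    (∀ (j k l : ℕ) (t : ℝ), 1 ≤ k → 2 ≤ l → l ≤ N → (l - 1) * N ^ k < j → j ≤ l * N ^ k →
      cechLandscape A j t = ENNReal.ofReal (hat (c ^ k * resolution A l) t)) := by
  have hcomp : IsCompact A := Metric.isCompact_of_isClosed_isBounded hA.isClosed hA.isBounded
  have hinj : ∀ j, (ψ j).Injective := fun j x y hxy => by
    have h := hψ j x y
    rw [hxy, dist_self, zero_eq_mul] at h
    exact dist_eq_zero.1 (h.resolve_left hc0.ne')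
  have hN : 0 < N := by
    obtain ⟨x, hx⟩ := hA.nonempty
    obtain ⟨i, -⟩ := hA.exists_preimage hx
    exact i.pos
  have hland : ∀ (j : ℕ) (t : ℝ), 1 ≤ j →
      cechLandscape A j t = ENNReal.ofReal (hat (resolution A j) t) :=
    fun j t hj => cechLandscape_eq_hat hcomp hA.nonempty hj t
  have hbound : ∀ j, 1 ≤ j → |resolution A j| ≤ Metric.diam A := fun j hj => by
    rw [abs_of_nonneg (resolution_nonneg A j)]
    exact resolution_le_diam hcomp hA.isClosed hj
  have hcontr := contractingWith_landscapeOperator N hc0 hc1 (resolution A)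
  have hfix : landscapeOperator N hc0 (resolution A) (hatSeq (resolution A) hbound) =
      hatSeq (resolution A) hbound :=
    landscapeOperator_hatSeq hc0 hbound fun j hj =>
      resolution_rescale hc0 hψ hinj hA hcomp hsep hN hj
  refine ⟨⟨landscapeLinear N hc0, landscapeOperator_eq_add N hc0 _⟩, hcontr, fun j t => ?_,
    ⟨hatSeq (resolution A) hbound, fun j => ?_, hfix, fun g hg => ?_, fun g => ?_⟩,
    fun j t hj _ => hland j t hj, fun j k l t _ hl _ h1 h2 => ?_⟩
  · rw [hland j t j.pos]
    exact ENNReal.ofReal_ne_top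
  · refine (coeFn_hatLp (resolution A j)).trans (Filter.Eventually.of_forall fun t => ?_)
    simp only [hland j t j.pos]
    exact (ENNReal.toReal_ofReal (le_max_left _ _)).symm
  · exact hcontr.fixedPoint_unique' hg hfix
  · exact hcontr.tendsto_iterate_of_isFixedPt hfix g
  · rw [hland j t (by omega), resolution_eq_pow_mul hc0 hψ hinj hA hcomp hsep hN hl k h1 h2]
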